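/- Let $n\ge 2$ and let $q\in\mathbb C^*$ not be a root of unity. Let $R=q\sum_i E_{ii}\otimes E_{ii}+\sum_{i\ne j}E_{ii}\otimes E_{jj}+(q-q^{-1})\sum_{i>j}E_{ij}\otimes E_{ji}$. Let $U_q$ be the quantized enveloping algebra of type $A_{n-1}$ in the FRT formulation, with independent diagonal generators $l^{(\pm)}_{ii}=q^{\pm\epsilon_i}$, $1\le i\le n$ (no quantum-determinant relation is imposed): it is the unital associative $\mathbb C$-algebra generated by the entries of an upper triangular matrix $L^{(+)}=(l^{(+)}_{ij})_{1\le i,j\le n}$ and a lower triangular matrix $L^{(-)}=(l^{(-)}_{ij})_{1\le i,j\le n}$ subject to $l^{(+)}_{ii}l^{(-)}_{ii}=l^{(-)}_{ii}l^{(+)}_{ii}=1$, $RL^{(\pm)}_1L^{(\pm)}_2=L^{(\pm)}_2L^{(\pm)}_1R$ and $RL^{(-)}_1L^{(+)}_2=L^{(+)}_2L^{(-)}_1R$, where $L_1=L\otimes 1$ and $L_2=1\otimes L$. For $1\le k\le n-1$ put $$c_k=\sum_{\sigma,\sigma'\in\mathfrak S_n}(-q)^{l(\sigma)+l(\sigma')}\,l^{(+)}_{\sigma_1\sigma'_1}\cdots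 l^{(+)}_{\sigma_k\sigma'_k}\,l^{(-)}_{\sigma_{k+1}\sigma'_{k+1}}\cdots l^{(-)}_{\sigma_n\sigma'_n},$$ where $l(\sigma)=\#\{i<j:\sigma_i>\sigma_j\}$. Then $c_k$ is central in $U_q$. Moreover, let $\lambda=(\lambda_1\ge\dots\ge\lambda_n\ge0)$ be a partition and let $V(\lambda)$ be the irreducible $U_q$-module with lowest weight $-\lambda$, that is, an irreducible module containing a nonzero vector $v_0$ with $l^{(+)}_{ii}v_0=q^{-\lambda_i}v_0$ for all $i$ and $l^{(-)}_{ij}v_0=0$ for all $i>j$. Then $c_k$ acts on $V(\lambda)$ as multiplication by the scalar $$q^{|\lambda|+\binom n2+k(n-1)}\,[k]!\,[n-k]!\sum_{1\le i_1<\dots<i_k\le n}q^{-2\lambda_{i_1}-\dots-2\lambda_{i_k}+2(i_1-n)+\dots+2(i_k-n)},$$ where $|\lambda|=\lambda_1+\dots+\lambda_n$, $[m]=\frac{q^m-q^{-m}}{q-q^{-1}}$ and $[m]!=[1][2]\cdots[m]$. -/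

import Mathlib

open scoped Kronecker

universe u

noncomputable section

namespace QuantumFRT

/-- The `R`-matrix of type `A_{n-1}` on `ℂⁿ ⊗ ℂⁿ`:
`R = q ∑ E_ii ⊗ E_ii + ∑_{i ≠ j} E_ii ⊗ E_jj + (q - q⁻¹) ∑_{i > j} E_ij ⊗ E_ji`.
The entry in row `(a.1, a.2)` and column `(b.1, b.2)` is the coefficient of
`E_{a.1 b.1} ⊗ E_{a.2 b.2}`. -/
def rMatrix (q : ℂ) (n : ℕ) : Matrix (Fin n × Fin n) (Fin n × Fin n) ℂ := fun a b =>
  if a = b then (if a.1 = a.2 then q else 1)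
  else if a.1 = b.2 ∧ a.2 = b.1 ∧ a.2 < a.1 then q - q⁻¹
  else 0

/-- The symbols `l⁺_ij` and `l⁻_ij`. -/
inductive Gen (n : ℕ) : Type
  | plus (i j : Fin n) : Gen n
  | minus (i j : Fin n) : Gen n

/-- The matrix of free generators `l⁺_ij`. -/
def freeLPlus (n : ℕ) : Matrix (Fin n) (Fin n) (FreeAlgebra ℂ (Gen n)) :=
  fun i j => FreeAlgebra.ι ℂ (Gen.plus i j)

/-- The matrix of free generators `l⁻_ij`. -/
def freeLMinus (n : ℕ) : Matrix (Fin n) (Fin n) (FreeAlgebra ℂ (Gen n)) :=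
  fun i j => FreeAlgebra.ι ℂ (Gen.minus i j)

section legs

variable {n : ℕ} {A : Type*} [Ring A]

/-- `M₁ = M ⊗ 1`. -/
def leg₁ (M : Matrix (Fin n) (Fin n) A) : Matrix (Fin n × Fin n) (Fin n × Fin n) A :=
  M ⊗ₖ (1 : Matrix (Fin n) (Fin n) A)

/-- `M₂ = 1 ⊗ M`. -/
def leg₂ (M : Matrix (Fin n) (Fin n) A) : Matrix (Fin n × Fin n) (Fin n × Fin n) A :=
  (1 : Matrix (Fin n) (Fin n) A) ⊗ₖ M

end legs

/-- The `R`-matrix with its scalar entries viewed in the free algebra. -/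
def freeR (q : ℂ) (n : ℕ) :
    Matrix (Fin n × Fin n) (Fin n × Fin n) (FreeAlgebra ℂ (Gen n)) :=
  (rMatrix q n).map (algebraMap ℂ (FreeAlgebra ℂ (Gen n)))

/-- The defining relations of the quantized enveloping algebra in the
Faddeev–Reshetikhin–Takhtajan formulation: `L⁺` is upper triangular, `L⁻` is lower triangular,
`l⁺_ii l⁻_ii = l⁻_ii l⁺_ii = 1`, and
`R L₁^± L₂^± = L₂^± L₁^± R`, `R L₁⁻ L₂⁺ = L₂⁺ L₁⁻ R` entry by entry. -/
inductive Rel (q : ℂ) (n : ℕ) : FreeAlgebra ℂ (Gen n) → FreeAlgebra ℂ (Gen n) → Prop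
  | plus_upper (i j : Fin n) (h : j < i) : Rel q n (freeLPlus n i j) 0
  | minus_lower (i j : Fin n) (h : i < j) : Rel q n (freeLMinus n i j) 0
  | plus_mul_minus (i : Fin n) : Rel q n (freeLPlus n i i * freeLMinus n i i) 1
  | minus_mul_plus (i : Fin n) : Rel q n (freeLMinus n i i * freeLPlus n i i) 1
  | plus_plus (a b : Fin n × Fin n) :
      Rel q n ((freeR q n * leg₁ (freeLPlus n) * leg₂ (freeLPlus n)) a b)
        ((leg₂ (freeLPlus n) * leg₁ (freeLPlus n) * freeR q n) a b)
  | minus_minus (a b : Fin n × Fin n) :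
      Rel q n ((freeR q n * leg₁ (freeLMinus n) * leg₂ (freeLMinus n)) a b)
        ((leg₂ (freeLMinus n) * leg₁ (freeLMinus n) * freeR q n) a b)
  | minus_plus (a b : Fin n × Fin n) :
      Rel q n ((freeR q n * leg₁ (freeLMinus n) * leg₂ (freeLPlus n)) a b)
        ((leg₂ (freeLPlus n) * leg₁ (freeLMinus n) * freeR q n) a b)

/-- The quantized enveloping algebra in the FRT formulation, with free diagonal part: the
elements `l⁺_ii = q^{ε_i}` are independent. With `q^{α_i} = l⁺_ii l⁻_{i+1,i+1}`, the entries
`l⁺_{i,i+1}` and `l⁻_{i+1,i}` are multiples of `e_i` and `f_i` up to diagonal factors. -/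
abbrev Uq (q : ℂ) (n : ℕ) : Type := RingQuot (Rel q n)

/-- The generating matrix `L⁺`. -/
def LPlus (q : ℂ) (n : ℕ) : Matrix (Fin n) (Fin n) (Uq q n) :=
  fun i j => RingQuot.mkAlgHom ℂ (Rel q n) (freeLPlus n i j)

/-- The generating matrix `L⁻`. -/
def LMinus (q : ℂ) (n : ℕ) : Matrix (Fin n) (Fin n) (Uq q n) :=
  fun i j => RingQuot.mkAlgHom ℂ (Rel q n) (freeLMinus n i j)

/-- `l(σ)`, the number of pairs `i < j` with `σ i > σ j`. -/
def inversions {n : ℕ} (σ : Equiv.Perm (Fin n)) : ℕ :=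
  (Finset.univ.filter fun p : Fin n × Fin n => p.1 < p.2 ∧ σ p.2 < σ p.1).card

/-- `c_k = ∑_{σ,σ'} (-q)^{l(σ)+l(σ')} l⁺_{σ₁σ'₁} ⋯ l⁺_{σ_kσ'_k} l⁻_{σ_{k+1}σ'_{k+1}} ⋯ l⁻_{σ_nσ'_n}`,
the factors multiplied in this order. -/
def centralElement (q : ℂ) (n k : ℕ) : Uq q n :=
  ∑ σ : Equiv.Perm (Fin n), ∑ σ' : Equiv.Perm (Fin n),
    (-q) ^ (inversions σ + inversions σ') •
      (List.ofFn fun i : Fin n =>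
        if (i : ℕ) < k then LPlus q n (σ i) (σ' i) else LMinus q n (σ i) (σ' i)).prod

/-- `v` is a lowest weight vector of weight `∑ μ_i ε_i`: it is nonzero, `q^{ε_i} = l⁺_ii` acts on
it by `q^{μ_i}`, and the strictly lower triangular entries of `L⁻` kill it. -/
structure IsLowestWeightVector (q : ℂ) (n : ℕ) (μ : Fin n → ℤ) {V : Type*} [AddCommGroup V]
    [Module ℂ V] [Module (Uq q n) V] (v : V) : Prop where
  ne_zero : v ≠ 0
  diag_smul : ∀ i, LPlus q n i i • v = q ^ μ i • v
  lower_smul : ∀ i j, j < i → LMinus q n i j • v = 0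

/-- The `q`-integer `[m] = (q^m - q^{-m}) / (q - q⁻¹)`. -/
def qInt (q : ℂ) (m : ℕ) : ℂ := (q ^ m - (q⁻¹) ^ m) / (q - q⁻¹)

/-- `[m]! = [1] [2] ⋯ [m]`. -/
def qFactorial (q : ℂ) (m : ℕ) : ℂ := ∏ i ∈ Finset.range m, qInt q (i + 1)

end QuantumFRT

end

/-! Let ω be the top `q`-antisymmetric tensor, with coefficients `topForm`. The element c_k
contracts one copy of ω with the row indices and one with the column indices of X₁ ⋯ X_n, where X_i
is L⁺ for the first k positions and L⁻ afterwards. Pulling an entry of L⁻ through this product by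
the exchange relations costs one R-matrix per position, on the rows and on the columns. The
composite of these R-matrices preserves antisymmetry in the tensor indices, and antisymmetric
tensors of top degree are multiples of ω; by triangularity the composite multiplies e_a ⊗ ω by q.
The factor q appears on both sides and cancels (`commute_qDetSum`). Entries of L⁺ are treated by
transposing all matrices.

On the lowest weight vector, triangularity leaves only the terms with σ = σ' (`prod_entries_smul`),
so the eigenvalue is a sum of q^{2l(σ)} times a product of weights. Removing the largest value of σ
gives a recursion solved by q-factorials times an elementary symmetric function (`invGen_eq`).
Centrality and simplicity extend the scalar to the whole module. -/

noncomputable section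

namespace QuantumFRT

/-! ### The top `q`-antisymmetric tensor. -/

/-- The number of pairs `i < j` with `f j < f i`. -/
def invCount {n : ℕ} (f : Fin n → Fin n) : ℕ :=
  (Finset.univ.filter fun p : Fin n × Fin n => p.1 < p.2 ∧ f p.2 < f p.1).card

/-- A neighbouring transposition keeps the order of every pair of positions except `(i, j)`, so
inversions correspond bijectively apart from the new one at `(i, j)`. -/
theorem invCount_comp_swap {n : ℕ} (f : Fin n → Fin n) {i j : Fin n} (hij : (i : ℕ) + 1 = j)
    (h : f i < f j) : invCount (f ∘ Equiv.swap i j) = invCount f + 1 := by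
  have hne : i ≠ j := by rintro rfl; omega
  have hlt : i < j := by rw [Fin.lt_def]; omega
  have hs : ∀ a b : Fin n, (a, b) ≠ (i, j) → a < b → Equiv.swap i j a < Equiv.swap i j b := by
    intro a b hab hlt
    rw [Equiv.swap_apply_def, Equiv.swap_apply_def]
    simp only [ne_eq, Prod.mk.injEq, not_and] at hab
    simp only [Fin.ext_iff, Fin.lt_def] at *
    split_ifs <;> omega
  have hmem : (i, j) ∈ Finset.univ.filter fun p : Fin n × Fin n =>
      p.1 < p.2 ∧ (f ∘ Equiv.swap i j) p.2 < (f ∘ Equiv.swap i j) p.1 := by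
    simp [hlt, h]
  unfold invCount
  rw [← Finset.card_erase_add_one hmem]
  congr 1
  refine Finset.card_nbij' (fun p => (Equiv.swap i j p.1, Equiv.swap i j p.2))
    (fun p => (Equiv.swap i j p.1, Equiv.swap i j p.2)) ?_ ?_ ?_ ?_
  · rintro ⟨a, b⟩ hp
    simp only [Finset.coe_erase, Finset.coe_filter, Set.mem_sdiff, Set.mem_ofPred_eq,
      Finset.mem_univ, true_and, Function.comp, Set.mem_singleton_iff] at hp ⊢
    exact ⟨hs a b hp.2 hp.1.1, hp.1.2⟩
  · rintro ⟨a, b⟩ hp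
    simp only [Finset.coe_erase, Finset.coe_filter, Set.mem_sdiff, Set.mem_ofPred_eq,
      Finset.mem_univ, true_and, Function.comp, Set.mem_singleton_iff,
      Equiv.swap_apply_self] at hp ⊢
    have hab : (a, b) ≠ (i, j) := by
      rintro ⟨⟩
      exact absurd h (not_lt.mpr hp.2.le)
    refine ⟨⟨hs a b hab hp.1, hp.2⟩, ?_⟩
    rintro he
    simp only [Prod.mk.injEq] at he
    have h1 : a = j := by rw [← Equiv.swap_apply_self i j a, he.1, Equiv.swap_apply_left]
    have h2 : b = i := by rw [← Equiv.swap_apply_self i j b, he.2, Equiv.swap_apply_right]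
    rw [h1, h2] at hp
    exact absurd hp.1 (not_lt.mpr hlt.le)
  · rintro ⟨a, b⟩ -
    simp
  · rintro ⟨a, b⟩ -
    simp

/-- The coefficients of the `q`-antisymmetric tensor of top degree. -/
def topForm (q : ℂ) {n : ℕ} (f : Fin n → Fin n) : ℂ :=
  open Classical in if Function.Bijective f then (-q) ^ invCount f else 0

theorem topForm_perm (q : ℂ) {n : ℕ} (σ : Equiv.Perm (Fin n)) :
    topForm q (σ : Fin n → Fin n) = (-q) ^ inversions σ := by
  rw [topForm, if_pos σ.bijective]
  rfl

theorem topForm_eq_zero (q : ℂ) {n : ℕ} {f : Fin n → Fin n} {i j : Fin n} (hij : i ≠ j)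
    (h : f i = f j) : topForm q f = 0 := by
  rw [topForm, if_neg]
  exact fun hf => hij (hf.1 h)

theorem topForm_comp_swap (q : ℂ) {n : ℕ} (f : Fin n → Fin n) {i j : Fin n}
    (hij : (i : ℕ) + 1 = j) (h : f i < f j) :
    topForm q (f ∘ Equiv.swap i j) = -q * topForm q f := by
  by_cases hf : Function.Bijective f
  · rw [topForm, topForm, if_pos hf, if_pos (hf.comp (Equiv.bijective _)),
      invCount_comp_swap f hij h, pow_succ, mul_comm]
  · rw [topForm, topForm, if_neg hf, if_neg, mul_zero]
    intro h'
    apply hf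
    have := h'.comp (Equiv.swap i j).bijective
    rwa [Function.comp_assoc, ← Equiv.coe_trans, Equiv.swap_swap] at this

/-- Sums over permutations are extended by zero to all functions because `op` replaces single values
and so leaves the set of permutations. -/
theorem sum_topForm_smul (q : ℂ) {n : ℕ} {M : Type*} [AddCommGroup M] [Module ℂ M]
    (F : (Fin n → Fin n) → M) :
    ∑ f, topForm q f • F f = ∑ σ : Equiv.Perm (Fin n), (-q) ^ inversions σ • F σ := by
  symm
  refine Finset.sum_of_injOn (fun σ : Equiv.Perm (Fin n) => (σ : Fin n → Fin n)) ?_ ?_ ?_ ?_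
  · intro a _ b _ hab
    exact DFunLike.coe_injective hab
  · simp
  · intro f _ hf
    rw [topForm, if_neg, zero_smul]
    intro hb
    exact hf ⟨Equiv.ofBijective f hb, by simp, rfl⟩
  · intro σ _
    rw [topForm_perm]

/-- A function on tensor indices that vanishes when two neighbouring indices agree and is
multiplied by `-q` when an increasing neighbouring pair is exchanged. -/
def AntisymmAt (q : ℂ) {n : ℕ} (i j : Fin n) (t : (Fin n → Fin n) → ℂ) : Prop :=
  ∀ f, (f i = f j → t f = 0) ∧ (f i < f j → t (f ∘ Equiv.swap i j) = -q * t f)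

theorem topForm_antisymmAt (q : ℂ) {n : ℕ} {i j : Fin n} (hij : (i : ℕ) + 1 = j) :
    AntisymmAt q i j (topForm q) := fun f =>
  ⟨topForm_eq_zero q (by rintro rfl; omega), topForm_comp_swap q f hij⟩

theorem strictMono_of_lt_next {n : ℕ} (f : Fin n → Fin n)
    (h : ∀ i j : Fin n, (i : ℕ) + 1 = j → f i < f j) : StrictMono f := by
  cases n with
  | zero => exact fun i => i.elim0
  | succ n => exact Fin.strictMono_iff_lt_succ.2 fun i => h _ _ (by simp)

/-- Bubble sort: at a neighbouring descent one exchange lowers the inversion count, at a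
neighbouring equality both sides vanish, and only the identity has neither. -/
theorem eq_topForm_mul {q : ℂ} {n : ℕ} (t : (Fin n → Fin n) → ℂ)
    (ht : ∀ i j : Fin n, (i : ℕ) + 1 = j → AntisymmAt q i j t) (f : Fin n → Fin n) :
    t f = topForm q f * t id := by
  induction hm : invCount f using Nat.strong_induction_on generalizing f with
  | _ m ih =>
    by_cases hf : ∀ i j : Fin n, (i : ℕ) + 1 = j → f i < f j
    · have hid : f = id := (strictMono_of_lt_next f hf).eq_id
      subst hid
      have : topForm q (id : Fin n → Fin n) = 1 := by
        rw [topForm, if_pos Function.bijective_id]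
        have : invCount (id : Fin n → Fin n) = 0 := by
          unfold invCount
          rw [Finset.card_eq_zero, Finset.filter_eq_empty_iff]
          rintro ⟨a, b⟩ - ⟨h1, h2⟩
          exact absurd h1 (not_lt.mpr (le_of_lt h2))
        rw [this, pow_zero]
      rw [this, one_mul]
    · push Not at hf
      obtain ⟨i, j, hij, hle⟩ := hf
      have hne : i ≠ j := by rintro rfl; omega
      rcases hle.eq_or_lt with he | hlt
      · rw [(ht i j hij f).1 he.symm, topForm_eq_zero q hne he.symm, zero_mul]
      · set g := f ∘ Equiv.swap i j with hg
        have hfg : f = g ∘ Equiv.swap i j := by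
          rw [hg, Function.comp_assoc, ← Equiv.coe_trans, Equiv.swap_swap]; rfl
        have hgl : g i < g j := by simpa [hg] using hlt
        have hinv := invCount_comp_swap g hij hgl
        rw [← hfg] at hinv
        rw [hfg, (ht i j hij g).2 hgl, topForm_comp_swap q g hij hgl, ih _ (by omega) g rfl,
          mul_assoc]

/-! ### R-matrices acting on an auxiliary index and the top tensor. -/

section transfer

variable {n : ℕ} {M : Type*} [AddCommGroup M] [Module ℂ M]

/-- The `R`-matrix acting on an auxiliary index and the `i`-th tensor index, where `r` orders
the indices. -/
def op (q : ℂ) (r : Fin n → Fin n → Prop) [DecidableRel r] (i : Fin n)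
    (t : Fin n → (Fin n → Fin n) → M) : Fin n → (Fin n → Fin n) → M := fun a f =>
  (if a = f i then q else 1) • t a f +
    (if r (f i) a then q - q⁻¹ else 0) • t (f i) (Function.update f i a)

/-- Transposing the R-matrix reverses the order relation; the off-diagonal terms are matched by the
involution exchanging `a` with `f i`. -/
theorem sum_op_transpose (q : ℂ) (r r' : Fin n → Fin n → Prop) [DecidableRel r] [DecidableRel r']
    (hr : ∀ a b, r a b ↔ r' b a) (i : Fin n) (u : Fin n → (Fin n → Fin n) → ℂ)
    (t : Fin n → (Fin n → Fin n) → M) :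
    ∑ a, ∑ f, op q r i u a f • t a f = ∑ a, ∑ f, u a f • op q r' i t a f := by
  simp only [← Fintype.sum_prod_type']
  unfold op
  simp only [smul_add, add_smul, Finset.sum_add_distrib]
  congr 1
  · refine Finset.sum_congr rfl fun x _ => ?_
    rw [smul_smul, smul_eq_mul, mul_comm]
  · have hinv : Function.Involutive fun x : Fin n × (Fin n → Fin n) =>
        (x.2 i, Function.update x.2 i x.1) := by
      rintro ⟨a, f⟩
      simp
    refine Finset.sum_equiv hinv.toPerm (by simp) ?_
    rintro ⟨a, f⟩ -
    simp only [Function.Involutive.coe_toPerm, Function.update_self, Function.update_idem,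
      Function.update_eq_self, smul_smul, smul_eq_mul, hr]
    rw [mul_comm]

theorem op_op_update (q : ℂ) (r : Fin n → Fin n → Prop) [DecidableRel r] {i j : Fin n}
    (hij : i ≠ j) (t : Fin n → (Fin n → Fin n) → ℂ) (a x y : Fin n) (f : Fin n → Fin n)
    (T : Fin n → Fin n → Fin n → ℂ)
    (hT : ∀ a x y, t a (Function.update (Function.update f i x) j y) = T a x y) :
    op q r j (op q r i t) a (Function.update (Function.update f i x) j y) =
      (if a = y then q else 1) * ((if a = x then q else 1) * T a x y +
        (if r x a then q - q⁻¹ else 0) * T x a y) +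
      (if r y a then q - q⁻¹ else 0) * ((if y = x then q else 1) * T y x a +
        (if r x y then q - q⁻¹ else 0) * T x y a) := by
  have h1 : ∀ z w, Function.update (Function.update (Function.update f i x) j z) i w =
      Function.update (Function.update f i w) j z := by
    intro z w
    rw [Function.update_comm hij.symm, Function.update_idem, Function.update_comm hij]
  simp [op, hij, h1, hT]

/-- A consequence of the Yang–Baxter equation, checked by hand: `P` is the product of two R-matrices
sharing the auxiliary index `a`, and the cases are the relative orders of `a`, `x`, `y`. -/
theorem antisymm_local_lt {q : ℂ} (hq0 : q ≠ 0) (T : Fin n → Fin n → Fin n → ℂ)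
    (h0 : ∀ a x, T a x x = 0) (h1 : ∀ a x y, x < y → T a y x = -q * T a x y)
    (P : Fin n → Fin n → Fin n → ℂ) (hP : ∀ a x y, P a x y =
      (if a = y then q else 1) * ((if a = x then q else 1) * T a x y +
        (if x < a then q - q⁻¹ else 0) * T x a y) +
      (if y < a then q - q⁻¹ else 0) * ((if y = x then q else 1) * T y x a +
        (if x < y then q - q⁻¹ else 0) * T x y a)) (a x y : Fin n) :
    (x = y → P a x y = 0) ∧ (x < y → P a y x = -q * P a x y) := by
  refine ⟨?_, fun hxy => ?_⟩
  · rintro rfl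
    rw [hP]
    rcases lt_trichotomy a x with h | h | h
    · simp [h.ne, h.not_gt, h0]
    · simp [h, h0]
    · simp [h.ne', h, h0, h1 x x a h]
  · rw [hP, hP]
    rcases lt_trichotomy a x with h | h | h
    · have h2 := h.trans hxy
      simp [h.ne, h.not_gt, h2.ne, h2.not_gt, h1 a x y hxy]
    · subst h
      simp [hxy.ne, hxy.ne', hxy, hxy.not_gt, h0, h1 a a y hxy]
    · rcases lt_trichotomy a y with h2 | h2 | h2
      · simp [h.ne', h, h2.ne, h2.not_gt, hxy.ne, hxy.ne', hxy, hxy.not_gt, h1 a x y hxy,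
          h1 x a y h2]
        field_simp
        ring
      · subst h2
        simp [h.ne', h.not_gt, h, h0, h1 a x a hxy]
      · simp [h.ne', h, h2, h2.ne', hxy.ne, hxy.ne', hxy, hxy.not_gt, h1 a x y hxy, h1 x y a h2,
          h1 y x a h]
        field_simp
        ring

/-- The counterpart for the transposed R-matrix, whose two factors must be composed in the opposite
order. -/
theorem antisymm_local_gt {q : ℂ} (hq0 : q ≠ 0) (T : Fin n → Fin n → Fin n → ℂ)
    (h0 : ∀ a x, T a x x = 0) (h1 : ∀ a x y, x < y → T a y x = -q * T a x y)
    (P : Fin n → Fin n → Fin n → ℂ) (hP : ∀ a x y, P a x y =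
      (if a = x then q else 1) * ((if a = y then q else 1) * T a x y +
        (if y > a then q - q⁻¹ else 0) * T y x a) +
      (if x > a then q - q⁻¹ else 0) * ((if x = y then q else 1) * T x a y +
        (if y > x then q - q⁻¹ else 0) * T y a x)) (a x y : Fin n) :
    (x = y → P a x y = 0) ∧ (x < y → P a y x = -q * P a x y) := by
  refine ⟨?_, fun hxy => ?_⟩
  · rintro rfl
    rw [hP]
    rcases lt_trichotomy a x with h | h | h
    · simp [h.ne, h, h0, h1 x a x h]
    · simp [h, h0]
    · simp [h.ne', h.not_gt, h0]
  · rw [hP, hP]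
    rcases lt_trichotomy a x with h | h | h
    · have h2 := h.trans hxy
      simp [h.ne, h, h2, h2.ne, hxy.ne, hxy.ne', hxy, hxy.not_gt, h1 a x y hxy, h1 x a y h2,
        h1 y a x h]
      field_simp
      ring
    · subst h
      simp [hxy.ne, hxy.ne', hxy, hxy.not_gt, h0, h1 a a y hxy]
    · rcases lt_trichotomy a y with h2 | h2 | h2
      · simp [h.ne', h.not_gt, h2, h2.ne, hxy.ne, hxy.ne', hxy, hxy.not_gt, h1 a x y hxy,
          h1 y x a h]
        field_simp
        ring
      · subst h2
        simp [h.ne', h.not_gt, h, h0, h1 a x a hxy]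
      · simp [h.ne', h.not_gt, h2.ne', h2.not_gt, hxy.ne, hxy.ne', hxy, hxy.not_gt, h1 a x y hxy]

/-- The composite of the operators `op q r i` over a list of positions, the last entry of the
list acting first. -/
def opList (q : ℂ) (r : Fin n → Fin n → Prop) [DecidableRel r] (l : List (Fin n))
    (t : Fin n → (Fin n → Fin n) → M) : Fin n → (Fin n → Fin n) → M :=
  l.foldr (op q r) t

theorem opList_cons (q : ℂ) (r : Fin n → Fin n → Prop) [DecidableRel r] (i : Fin n)
    (l : List (Fin n)) (t : Fin n → (Fin n → Fin n) → M) :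
    opList q r (i :: l) t = op q r i (opList q r l t) := rfl

theorem opList_append (q : ℂ) (r : Fin n → Fin n → Prop) [DecidableRel r]
    (l l' : List (Fin n)) (t : Fin n → (Fin n → Fin n) → M) :
    opList q r (l ++ l') t = opList q r l (opList q r l' t) := by
  simp [opList]

theorem update_comp_swap {i j p : Fin n} (hi : p ≠ i) (hj : p ≠ j) (f : Fin n → Fin n)
    (a : Fin n) : Function.update (f ∘ Equiv.swap i j) p a =
      Function.update f p a ∘ Equiv.swap i j := by
  funext x
  rcases eq_or_ne x p with rfl | hx
  · simp [Equiv.swap_apply_of_ne_of_ne hi hj]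
  · have : Equiv.swap i j x ≠ p := by
      intro h
      apply hx
      rw [← Equiv.swap_apply_self i j x, h, Equiv.swap_apply_of_ne_of_ne hi hj]
    simp [hx, this]

theorem op_antisymmAt {q : ℂ} (r : Fin n → Fin n → Prop) [DecidableRel r] {i j p : Fin n}
    (hi : p ≠ i) (hj : p ≠ j) {t : Fin n → (Fin n → Fin n) → ℂ}
    (ht : ∀ a, AntisymmAt q i j (t a)) (a : Fin n) : AntisymmAt q i j (op q r p t a) := by
  intro f
  have hu : ∀ x, Function.update f p x i = f i ∧ Function.update f p x j = f j := fun x => by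
    simp [hi.symm, hj.symm]
  refine ⟨fun h => ?_, fun h => ?_⟩
  · have h' := (ht (f p) (Function.update f p a)).1 (by rw [(hu a).1, (hu a).2, h])
    rw [op, h', (ht a f).1 h, smul_zero, smul_zero, add_zero]
  · have h' := (ht (f p) (Function.update f p a)).2 (by rw [(hu a).1, (hu a).2]; exact h)
    simp only [op, update_comp_swap hi hj, Function.comp_apply,
      Equiv.swap_apply_of_ne_of_ne hi hj, h', (ht a f).2 h, smul_eq_mul]
    ring

theorem opList_antisymmAt {q : ℂ} (r : Fin n → Fin n → Prop) [DecidableRel r] {i j : Fin n}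
    {l : List (Fin n)} (hi : i ∉ l) (hj : j ∉ l) {t : Fin n → (Fin n → Fin n) → ℂ}
    (ht : ∀ a, AntisymmAt q i j (t a)) (a : Fin n) : AntisymmAt q i j (opList q r l t a) := by
  induction l generalizing a with
  | nil => exact ht a
  | cons p l ih =>
    simp only [List.mem_cons, not_or] at hi hj
    exact op_antisymmAt r (Ne.symm hi.1) (Ne.symm hj.1) (ih hi.2 hj.2) a

theorem update_update_swap {i j : Fin n} (hij : i ≠ j) (f : Fin n → Fin n) (x y : Fin n) :
    Function.update (Function.update f i x) j y ∘ Equiv.swap i j =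
      Function.update (Function.update f i y) j x := by
  funext z
  rcases eq_or_ne z i with rfl | hi
  · simp [hij]
  rcases eq_or_ne z j with rfl | hj
  · simp [hij]
  simp [Equiv.swap_apply_of_ne_of_ne hi hj, hi, hj]

/-- Antisymmetry at `(i, j)` in terms of the two entries. -/
theorem antisymmAt_iff {q : ℂ} {i j : Fin n} (hij : i ≠ j) (t : (Fin n → Fin n) → ℂ) :
    AntisymmAt q i j t ↔ ∀ f x y,
      (x = y → t (Function.update (Function.update f i x) j y) = 0) ∧
      (x < y → t (Function.update (Function.update f i y) j x) =
        -q * t (Function.update (Function.update f i x) j y)) := by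
  constructor
  · intro h f x y
    have := h (Function.update (Function.update f i x) j y)
    rw [update_update_swap hij] at this
    simpa [hij] using this
  · intro h f
    have := h f (f i) (f j)
    rw [← update_update_swap hij f (f i)] at this
    simpa only [Function.update_eq_self] using this

theorem op_lt_op_lt_antisymmAt {q : ℂ} (hq0 : q ≠ 0) {i j : Fin n} (hij : i ≠ j)
    {t : Fin n → (Fin n → Fin n) → ℂ} (ht : ∀ a, AntisymmAt q i j (t a)) (a : Fin n) :
    AntisymmAt q i j (op q (· < ·) j (op q (· < ·) i t) a) := by
  simp only [antisymmAt_iff hij] at ht ⊢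
  intro f
  exact antisymm_local_lt hq0 (fun a x y => t a (Function.update (Function.update f i x) j y))
    (fun a x => (ht a f x x).1 rfl) (fun a x y => (ht a f x y).2)
    (fun a x y => op q (· < ·) j (op q (· < ·) i t) a
      (Function.update (Function.update f i x) j y))
    (fun a x y => op_op_update q _ hij t a x y f _ fun _ _ _ => rfl) a

theorem op_gt_op_gt_antisymmAt {q : ℂ} (hq0 : q ≠ 0) {i j : Fin n} (hij : i ≠ j)
    {t : Fin n → (Fin n → Fin n) → ℂ} (ht : ∀ a, AntisymmAt q i j (t a)) (a : Fin n) :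
    AntisymmAt q i j (op q (· > ·) i (op q (· > ·) j t) a) := by
  simp only [antisymmAt_iff hij] at ht ⊢
  intro f
  refine antisymm_local_gt hq0 (fun a x y => t a (Function.update (Function.update f i x) j y))
    (fun a x => (ht a f x x).1 rfl) (fun a x y => (ht a f x y).2)
    (fun a x y => op q (· > ·) i (op q (· > ·) j t) a
      (Function.update (Function.update f i x) j y))
    (fun a x y => ?_) a
  have h := op_op_update q (· > ·) hij.symm t a y x f
    (fun a y x => t a (Function.update (Function.update f i x) j y)) fun _ _ _ => by
      rw [Function.update_comm hij]
  rwa [Function.update_comm hij.symm y x f] at h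

theorem finRange_eq_append {i j : Fin n} (hij : (i : ℕ) + 1 = j) :
    List.finRange n = (List.finRange n).take i ++ i :: j :: (List.finRange n).drop (j + 1) := by
  conv_lhs => rw [← List.take_append_drop i (List.finRange n)]
  congr 1
  rw [List.drop_eq_getElem_cons (by simp), hij, List.drop_eq_getElem_cons (by simp)]
  simp

theorem opList_vanish {q : ℂ} (r : Fin n → Fin n → Prop) [DecidableRel r]
    {t : Fin n → (Fin n → Fin n) → ℂ} {i j : Fin n}
    (ht : ∀ a f, f i = f j → t a f = 0) {l : List (Fin n)} (hi : i ∉ l) (hj : j ∉ l)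
    (a : Fin n) (f : Fin n → Fin n) (hf : f i = f j) : opList q r l t a f = 0 := by
  induction l generalizing a f with
  | nil => exact ht a f hf
  | cons p l ih =>
    simp only [List.mem_cons, not_or] at hi hj
    rw [opList_cons, op, ih hi.2 hj.2 a f hf, ih hi.2 hj.2, smul_zero, smul_zero, add_zero]
    simpa [hi.1, hj.1] using hf

/-- Triangularity: an off-diagonal term at position `p` puts the value `b` at both `p` and `b`, and
by the ordering of `l` neither position is acted on by the remaining operators, so `opList_vanish`
kills it. Only the diagonal factor `q` at position `b` survives. -/
theorem opList_apply_id {q : ℂ} (r : Fin n → Fin n → Prop) [DecidableRel r]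
    (hirr : ∀ a, ¬ r a a) (hasymm : ∀ a b, r a b → ¬ r b a)
    {t : Fin n → (Fin n → Fin n) → ℂ} (ht : ∀ i j, i ≠ j → ∀ a f, f i = f j → t a f = 0)
    {l : List (Fin n)} (hl : l.Pairwise fun a b => r b a) (b : Fin n) :
    opList q r l t b id = (if b ∈ l then q else 1) * t b id := by
  induction l with
  | nil => simp [opList]
  | cons p l ih =>
    rw [List.pairwise_cons] at hl
    have hpl : p ∉ l := fun h => hirr p (hl.1 p h)
    rw [opList_cons, op, ih hl.2]
    by_cases hb : b = p
    · subst hb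
      simp [hpl, hirr]
    · by_cases hr : r p b
      · have hbl : b ∉ l := fun h => hasymm _ _ hr (hl.1 b h)
        rw [opList_vanish r (ht p b (Ne.symm hb)) hpl hbl]
        · simp [hb]
        · simp [hb]
      · simp [hb, hr]

/-- The decomposable function `δ_a ⊗ ω` with `ω` the top form. -/
def deltaTop (q : ℂ) (a : Fin n) : Fin n → (Fin n → Fin n) → ℂ := fun b f =>
  if b = a then topForm q f else 0

theorem deltaTop_antisymmAt (q : ℂ) (a : Fin n) {i j : Fin n} (hij : (i : ℕ) + 1 = j)
    (b : Fin n) : AntisymmAt q i j (deltaTop q a b) := by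
  intro f
  unfold deltaTop
  have := topForm_antisymmAt q hij f
  split_ifs <;> simp_all

/-- Both sides are antisymmetric in the tensor indices, so comparison at the identity suffices. -/
theorem opList_deltaTop {q : ℂ} (r : Fin n → Fin n → Prop) [DecidableRel r]
    (hirr : ∀ a, ¬ r a a) (hasymm : ∀ a b, r a b → ¬ r b a)
    {l : List (Fin n)} (hl : l.Pairwise fun a b => r b a) (hmem : ∀ i, i ∈ l) (a : Fin n)
    (hanti : ∀ i j : Fin n, (i : ℕ) + 1 = j → ∀ b,
      AntisymmAt q i j (opList q r l (deltaTop q a) b)) (b : Fin n) (f : Fin n → Fin n) :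
    opList q r l (deltaTop q a) b f = q * deltaTop q a b f := by
  rw [eq_topForm_mul _ (fun i j hij => hanti i j hij b) f,
    opList_apply_id r hirr hasymm _ hl, if_pos (hmem b)]
  · have := eq_topForm_mul _ (fun i j hij => deltaTop_antisymmAt q a (i := i) (j := j) hij b) f
    rw [this]
    ring
  · intro i j hij b f hf
    unfold deltaTop
    rw [topForm_eq_zero q hij hf, ite_self]

theorem opList_gt_deltaTop {q : ℂ} (hq0 : q ≠ 0) (a b : Fin n) (f : Fin n → Fin n) :
    opList q (· > ·) (List.finRange n) (deltaTop q a) b f = q * deltaTop q a b f := by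
  refine opList_deltaTop (· > ·) (fun a => lt_irrefl a) (fun a b => lt_asymm)
    (List.pairwise_lt_finRange n) List.mem_finRange a ?_ b f
  intro i j hij b
  have hnd := List.nodup_finRange n
  have hne : i ≠ j := by rintro rfl; omega
  rw [finRange_eq_append hij] at hnd ⊢
  simp only [List.nodup_append, List.nodup_cons, List.mem_cons, not_or] at hnd
  rw [opList_append, opList_cons, opList_cons]
  -- Operators at positions other than `i`, `j` preserve antisymmetry there; the two at `i` and `j`
  -- are adjacent in the list and are handled as a pair.
  refine opList_antisymmAt _ (fun h => hnd.2.2 _ h _ (Or.inl rfl) rfl)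
    (fun h => hnd.2.2 _ h _ (Or.inr (Or.inl rfl)) rfl) ?_ b
  exact op_gt_op_gt_antisymmAt hq0 hne
    (opList_antisymmAt _ hnd.2.1.1.2 hnd.2.1.2.1 (deltaTop_antisymmAt q a hij))

theorem opList_lt_deltaTop {q : ℂ} (hq0 : q ≠ 0) (a b : Fin n) (f : Fin n → Fin n) :
    opList q (· < ·) (List.finRange n).reverse (deltaTop q a) b f = q * deltaTop q a b f := by
  refine opList_deltaTop (· < ·) (fun a => lt_irrefl a) (fun a b => lt_asymm)
    (List.pairwise_reverse.2 (List.pairwise_lt_finRange n)) (by simp) a ?_ b f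
  intro i j hij b
  have hnd := List.nodup_finRange n
  have hne : i ≠ j := by rintro rfl; omega
  rw [finRange_eq_append hij] at hnd ⊢
  simp only [List.nodup_append, List.nodup_cons, List.mem_cons, not_or] at hnd
  simp only [List.reverse_append, List.reverse_cons, List.append_assoc, List.cons_append,
    List.nil_append]
  rw [opList_append, opList_cons, opList_cons]
  refine opList_antisymmAt _ (by simpa using hnd.2.1.1.2) (by simpa using hnd.2.1.2.1) ?_ b
  refine op_lt_op_lt_antisymmAt hq0 hne (opList_antisymmAt _ ?_ ?_ (deltaTop_antisymmAt q a hij))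
  · exact fun h => hnd.2.2 _ (List.mem_reverse.1 h) _ (Or.inl rfl) rfl
  · exact fun h => hnd.2.2 _ (List.mem_reverse.1 h) _ (Or.inr (Or.inl rfl)) rfl

end transfer

/-! ### Moving a generator through a product of matrix entries. -/

section transfer

variable {n : ℕ} {U : Type*} [Ring U] [Algebra ℂ U]

/-- The entries of `R L₁ X₂ = X₂ L₁ R`. -/
def Exchange (q : ℂ) (L X : Matrix (Fin n) (Fin n) U) : Prop := ∀ i j k l,
  (if i = j then q else 1) • (L i k * X j l) + (if j < i then q - q⁻¹ else 0) • (L j k * X i l) =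
  (if k = l then q else 1) • (X j l * L i k) + (if k < l then q - q⁻¹ else 0) • (X j k * L i l)

/-- This turns the relation for L⁻ past L⁺ into one for the transpose of L⁺ past the transpose of
L⁻. -/
theorem Exchange.symm {q : ℂ} {L X : Matrix (Fin n) (Fin n) U} (h : Exchange q L X) :
    Exchange q X.transpose L.transpose := fun i j k l => by
  have h' := (h l k j i).symm
  simp only [eq_comm (a := j) (b := i), eq_comm (a := l) (b := k)] at h'
  exact h'

/-- The contraction of a four-index array with two two-index arrays. -/
def contract (u v : Fin n → (Fin n → Fin n) → ℂ)
    (Z : Fin n → (Fin n → Fin n) → Fin n → (Fin n → Fin n) → U) : U :=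
  ∑ a, ∑ f, u a f • ∑ c, ∑ h, v c h • Z a f c h

/-- Both operators are moved by transposition from the coefficients to the matrix entries, where the
identity is the exchange relation entry by entry. `P` and `Q` stand for the factors at the other
positions. -/
theorem contract_op {q : ℂ} {L X : Matrix (Fin n) (Fin n) U} (hLX : Exchange q L X) (j : Fin n)
    (P Q : (Fin n → Fin n) → (Fin n → Fin n) → U)
    (hP : ∀ f h x, P (Function.update f j x) h = P f h)
    (hP' : ∀ f h x, P f (Function.update h j x) = P f h)
    (hQ : ∀ f h x, Q (Function.update f j x) h = Q f h)
    (hQ' : ∀ f h x, Q f (Function.update h j x) = Q f h)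
    (u v : Fin n → (Fin n → Fin n) → ℂ) :
    contract (op q (· > ·) j u) v (fun a f c h => P f h * (L a c * X (f j) (h j)) * Q f h) =
      contract u (op q (· < ·) j v)
        (fun a f c h => P f h * (X (f j) (h j) * L a c) * Q f h) := by
  unfold contract
  rw [sum_op_transpose q (· > ·) (· < ·) (fun a b => Iff.rfl)]
  refine Finset.sum_congr rfl fun a _ => Finset.sum_congr rfl fun f _ => ?_
  rw [sum_op_transpose q (· < ·) (· > ·) (fun a b => Iff.rfl)]
  congr 1
  simp only [op, Finset.smul_sum, ← Finset.sum_add_distrib]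
  refine Finset.sum_congr rfl fun c _ => Finset.sum_congr rfl fun h _ => ?_
  rw [smul_comm _ (v c h), smul_comm _ (v c h), ← smul_add]
  congr 1
  simp only [hP, hP', hQ, hQ', Function.update_self]
  have := congrArg (fun z => P f h * z * Q f h) (hLX a (f j) c (h j))
  simpa only [mul_add, add_mul, mul_smul_comm, smul_mul_assoc] using this

/-- The matrix entries `X₁(f₁, h₁) ⋯ X_n(f_n, h_n)` as a list. -/
def entries {U : Type*} (X : Fin n → Matrix (Fin n) (Fin n) U) (f h : Fin n → Fin n) : List U :=
  List.ofFn fun i => X i (f i) (h i)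

theorem entries_congr_take {U : Type*} (X : Fin n → Matrix (Fin n) (Fin n) U)
    {f f' h h' : Fin n → Fin n}
    {m : ℕ} (hf : ∀ i : Fin n, (i : ℕ) < m → f i = f' i)
    (hh : ∀ i : Fin n, (i : ℕ) < m → h i = h' i) :
    (entries X f h).take m = (entries X f' h').take m := by
  refine List.ext_getElem (by simp [entries]) fun i h1 h2 => ?_
  simp only [entries, List.length_take, List.length_ofFn, lt_min_iff] at h1
  simp [entries, hf ⟨i, h1.2⟩ h1.1, hh ⟨i, h1.2⟩ h1.1]

theorem entries_congr_drop {U : Type*} (X : Fin n → Matrix (Fin n) (Fin n) U)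
    {f f' h h' : Fin n → Fin n}
    {m : ℕ} (hf : ∀ i : Fin n, m ≤ (i : ℕ) → f i = f' i)
    (hh : ∀ i : Fin n, m ≤ (i : ℕ) → h i = h' i) :
    (entries X f h).drop m = (entries X f' h').drop m := by
  refine List.ext_getElem (by simp [entries]) fun i h1 h2 => ?_
  simp only [entries, List.length_drop, List.length_ofFn] at h1
  simp [entries, hf ⟨m + i, by omega⟩ (by simp), hh ⟨m + i, by omega⟩ (by simp)]

/-- `X₁ ⋯ X_m L X_{m+1} ⋯ X_n`. -/
def interleave (L : Matrix (Fin n) (Fin n) U) (X : Fin n → Matrix (Fin n) (Fin n) U) (m : ℕ)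
    (a : Fin n) (f : Fin n → Fin n) (c : Fin n) (h : Fin n → Fin n) : U :=
  ((entries X f h).take m).prod * L a c * ((entries X f h).drop m).prod

theorem contract_interleave {q : ℂ} {L : Matrix (Fin n) (Fin n) U}
    {X : Fin n → Matrix (Fin n) (Fin n) U} (hLX : ∀ i, Exchange q L (X i)) (j : Fin n)
    (u v : Fin n → (Fin n → Fin n) → ℂ) :
    contract (op q (· > ·) j u) v (interleave L X j) =
      contract u (op q (· < ·) j v) (interleave L X (j + 1)) := by
  have hlt : ∀ (f : Fin n → Fin n) x (i : Fin n), (i : ℕ) < j → Function.update f j x i = f i :=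
    fun f x i hi => by rw [Function.update_of_ne]; rintro rfl; omega
  have hgt : ∀ (f : Fin n → Fin n) x (i : Fin n), (j : ℕ) + 1 ≤ i →
      Function.update f j x i = f i :=
    fun f x i hi => by rw [Function.update_of_ne]; rintro rfl; omega
  convert contract_op (hLX j) j (fun f h => ((entries X f h).take j).prod)
    (fun f h => ((entries X f h).drop (j + 1)).prod) ?_ ?_ ?_ ?_ u v using 2
  · funext a f c h
    rw [interleave, List.drop_eq_getElem_cons (by simp [entries]), List.prod_cons]
    simp [entries, mul_assoc]
  · funext a f c h
    rw [interleave, List.take_succ_eq_append_getElem (by simp [entries]), List.prod_append]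
    simp [entries, mul_assoc]
  · exact fun f h x => congrArg List.prod (entries_congr_take X (hlt f x) fun _ _ => rfl)
  · exact fun f h x => congrArg List.prod (entries_congr_take X (fun _ _ => rfl) (hlt h x))
  · exact fun f h x => congrArg List.prod (entries_congr_drop X (hgt f x) fun _ _ => rfl)
  · exact fun f h x => congrArg List.prod (entries_congr_drop X (fun _ _ => rfl) (hgt h x))

/-- Each step passes `L` over one factor and moves the outermost row operator to the outside of the
column operators, hence the reversed list. -/
theorem contract_opList {q : ℂ} {L : Matrix (Fin n) (Fin n) U}
    {X : Fin n → Matrix (Fin n) (Fin n) U} (hLX : ∀ i, Exchange q L (X i))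
    (u v : Fin n → (Fin n → Fin n) → ℂ) {m : ℕ} (hm : m ≤ n) :
    contract (opList q (· > ·) (List.finRange n) u) v (interleave L X 0) =
      contract (opList q (· > ·) ((List.finRange n).drop m) u)
        (opList q (· < ·) ((List.finRange n).take m).reverse v) (interleave L X m) := by
  induction m with
  | zero => simp [opList]
  | succ m ih =>
    rw [ih (by omega), List.drop_eq_getElem_cons (by simpa using hm), opList_cons,
      List.take_succ_eq_append_getElem (by simpa using hm), List.reverse_append,
      List.reverse_singleton, List.singleton_append, opList_cons]
    have := contract_interleave hLX ⟨m, hm⟩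
    simp only at this
    simp [this]

theorem contract_deltaTop (q : ℂ) (a c : Fin n)
    (Z : Fin n → (Fin n → Fin n) → Fin n → (Fin n → Fin n) → U) :
    contract (deltaTop q a) (deltaTop q c) Z =
      ∑ f, topForm q f • ∑ h, topForm q h • Z a f c h := by
  simp only [contract, deltaTop, ite_smul, zero_smul]
  rw [Finset.sum_eq_single a (fun b _ hb => by simp [hb]) (by simp)]
  refine Finset.sum_congr rfl fun f _ => ?_
  rw [if_pos rfl, Finset.sum_eq_single c (fun b _ hb => by simp [hb]) (by simp)]
  simp

theorem contract_smul_left (q : ℂ) (u v : Fin n → (Fin n → Fin n) → ℂ)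
    (Z : Fin n → (Fin n → Fin n) → Fin n → (Fin n → Fin n) → U) :
    contract (fun a f => q * u a f) v Z = q • contract u v Z := by
  simp only [contract, Finset.smul_sum, mul_smul]

theorem contract_smul_right (q : ℂ) (u v : Fin n → (Fin n → Fin n) → ℂ)
    (Z : Fin n → (Fin n → Fin n) → Fin n → (Fin n → Fin n) → U) :
    contract u (fun a f => q * v a f) Z = q • contract u v Z := by
  simp only [contract, Finset.smul_sum, mul_smul, smul_comm _ q]

/-- `∑_{σ,σ'} (-q)^{l(σ)+l(σ')} X₁(σ₁, σ'₁) ⋯ X_n(σ_n, σ'_n)`. -/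
def qDetSum (q : ℂ) (X : Fin n → Matrix (Fin n) (Fin n) U) : U :=
  ∑ σ : Equiv.Perm (Fin n), ∑ σ' : Equiv.Perm (Fin n),
    (-q) ^ (inversions σ + inversions σ') • (List.ofFn fun i => X i (σ i) (σ' i)).prod

theorem qDetSum_eq (q : ℂ) (X : Fin n → Matrix (Fin n) (Fin n) U) :
    qDetSum q X = ∑ f, topForm q f • ∑ h, topForm q h • (entries X f h).prod := by
  simp only [sum_topForm_smul q fun h => (entries X _ h).prod]
  rw [sum_topForm_smul q fun f => ∑ σ : Equiv.Perm (Fin n),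
    (-q) ^ inversions σ • (entries X f σ).prod]
  simp only [Finset.smul_sum, smul_smul, ← pow_add]
  rfl

theorem qDetSum_transpose (q : ℂ) (X : Fin n → Matrix (Fin n) (Fin n) U) :
    qDetSum q (fun i => (X i).transpose) = qDetSum q X := by
  unfold qDetSum
  rw [Finset.sum_comm]
  simp only [Matrix.transpose_apply, add_comm]

theorem commute_qDetSum {q : ℂ} (hq0 : q ≠ 0) {L : Matrix (Fin n) (Fin n) U}
    {X : Fin n → Matrix (Fin n) (Fin n) U} (hLX : ∀ i, Exchange q L (X i)) (a c : Fin n) :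
    L a c * qDetSum q X = qDetSum q X * L a c := by
  have h := contract_opList hLX (deltaTop q a) (deltaTop q c) le_rfl
  have h1 : opList q (· > ·) (List.finRange n) (deltaTop q a) =
      fun b f => q * deltaTop q a b f := by
    funext b f
    exact opList_gt_deltaTop hq0 a b f
  have h2 : opList q (· < ·) (List.finRange n).reverse (deltaTop q c) =
      fun b f => q * deltaTop q c b f := by
    funext b f
    exact opList_lt_deltaTop hq0 c b f
  rw [h1, List.drop_of_length_le (by simp), List.take_of_length_le (by simp), h2,
    contract_smul_left, contract_smul_right] at h
  -- The row operators gave `q` on the left and the column operators gave `q` on the right.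
  have h3 := smul_right_injective U hq0 h
  change contract (deltaTop q a) _ _ = contract (deltaTop q a) (deltaTop q c) _ at h3
  rw [contract_deltaTop, contract_deltaTop] at h3
  have h4 : ∀ f h, (entries X f h).length ≤ n := fun f h => by simp [entries]
  simpa [interleave, qDetSum_eq, Finset.mul_sum, Finset.sum_mul, List.take_of_length_le (h4 _ _),
    List.drop_of_length_le (h4 _ _)] using h3

end transfer

/-! ### Centrality of c_k. -/

section center

variable {q : ℂ} {n : ℕ}

theorem rMatrix_eq (q : ℂ) (n : ℕ) (a c : Fin n × Fin n) :
    rMatrix q n a c = (if a = c then (if a.1 = a.2 then q else 1) else 0) +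
      (if a.swap = c then (if a.2 < a.1 then q - q⁻¹ else 0) else 0) := by
  obtain ⟨i, j⟩ := a
  obtain ⟨k, l⟩ := c
  simp only [rMatrix, Prod.mk.injEq, Prod.swap_prod_mk]
  by_cases h : i = k ∧ j = l
  · obtain ⟨rfl, rfl⟩ := h
    by_cases hij : j = i
    · simp [hij]
    · simp [hij]
  · rw [if_neg h, if_neg h, zero_add]
    by_cases h2 : j = k ∧ i = l
    · simp [h2]
    · rw [if_neg h2, if_neg]
      tauto

section legs

variable {A : Type*} [Ring A]

theorem leg₁_mul_leg₂_apply (L X : Matrix (Fin n) (Fin n) A) (a b : Fin n × Fin n) :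
    (leg₁ L * leg₂ X) a b = L a.1 b.1 * X a.2 b.2 := by
  simp [leg₁, leg₂, Matrix.mul_apply, Fintype.sum_prod_type, Matrix.one_apply,
    Matrix.kroneckerMap_apply]

theorem leg₂_mul_leg₁_apply (L X : Matrix (Fin n) (Fin n) A) (a b : Fin n × Fin n) :
    (leg₂ X * leg₁ L) a b = X a.2 b.2 * L a.1 b.1 := by
  simp [leg₁, leg₂, Matrix.mul_apply, Fintype.sum_prod_type, Matrix.one_apply,
    Matrix.kroneckerMap_apply]

variable [Algebra ℂ A]

theorem rMatrix_mul_legs_apply (L X : Matrix (Fin n) (Fin n) A) (i j k l : Fin n) :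
    ((rMatrix q n).map (algebraMap ℂ A) * leg₁ L * leg₂ X) (i, j) (k, l) =
      (if i = j then q else 1) • (L i k * X j l) +
        (if j < i then q - q⁻¹ else 0) • (L j k * X i l) := by
  rw [mul_assoc, Matrix.mul_apply]
  simp only [leg₁_mul_leg₂_apply, Matrix.map_apply, ← Algebra.smul_def, rMatrix_eq, add_smul,
    Finset.sum_add_distrib, ite_smul (p := _ = _), zero_smul]
  simp

theorem legs_mul_rMatrix_apply (L X : Matrix (Fin n) (Fin n) A) (i j k l : Fin n) :
    (leg₂ X * leg₁ L * (rMatrix q n).map (algebraMap ℂ A)) (i, j) (k, l) =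
      (if k = l then q else 1) • (X j l * L i k) +
        (if k < l then q - q⁻¹ else 0) • (X j k * L i l) := by
  rw [Matrix.mul_apply]
  have hswap : ∀ c : Fin n × Fin n, c.swap = (k, l) ↔ c = (l, k) := fun c => by
    rw [← Prod.swap_inj, Prod.swap_swap, Prod.swap_prod_mk]
  simp only [leg₂_mul_leg₁_apply, Matrix.map_apply, ← Algebra.commutes, ← Algebra.smul_def,
    rMatrix_eq, add_smul, Finset.sum_add_distrib, ite_smul (p := _ = _), zero_smul, hswap]
  simp

end legs

theorem exchange_of_rel (L X : Matrix (Fin n) (Fin n) (FreeAlgebra ℂ (Gen n)))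
    (h : ∀ a b : Fin n × Fin n,
      Rel q n ((freeR q n * leg₁ L * leg₂ X) a b) ((leg₂ X * leg₁ L * freeR q n) a b)) :
    Exchange q (L.map (RingQuot.mkAlgHom ℂ (Rel q n))) (X.map (RingQuot.mkAlgHom ℂ (Rel q n))) := by
  intro i j k l
  have := RingQuot.mkAlgHom_rel ℂ (h (i, j) (k, l))
  rw [freeR, rMatrix_mul_legs_apply, legs_mul_rMatrix_apply] at this
  simpa only [map_add, map_smul, map_mul, Matrix.map_apply] using this

theorem exchange_plus_plus : Exchange q (LPlus q n) (LPlus q n) :=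
  exchange_of_rel _ _ Rel.plus_plus

theorem exchange_minus_minus : Exchange q (LMinus q n) (LMinus q n) :=
  exchange_of_rel _ _ Rel.minus_minus

theorem exchange_minus_plus : Exchange q (LMinus q n) (LPlus q n) :=
  exchange_of_rel _ _ Rel.minus_plus

theorem centralElement_eq (q : ℂ) (n k : ℕ) : centralElement q n k =
    qDetSum q fun i : Fin n => if (i : ℕ) < k then LPlus q n else LMinus q n := by
  unfold centralElement qDetSum
  congr! 8 with σ _ σ' _ i
  split_ifs with h <;> simp [h]

theorem commute_LMinus (hq0 : q ≠ 0) (k : ℕ) (i j : Fin n) :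
    Commute (LMinus q n i j) (centralElement q n k) := by
  rw [centralElement_eq]
  refine commute_qDetSum hq0 (fun p => ?_) i j
  split_ifs
  · exact exchange_minus_plus
  · exact exchange_minus_minus

/-- The defining relations give no direct `Exchange` of L⁺ past L⁻, but they do after transposition,
which leaves `qDetSum` unchanged. -/
theorem commute_LPlus (hq0 : q ≠ 0) (k : ℕ) (i j : Fin n) :
    Commute (LPlus q n i j) (centralElement q n k) := by
  rw [centralElement_eq, ← qDetSum_transpose]
  refine commute_qDetSum (L := (LPlus q n).transpose) hq0 (fun p => ?_) j i
  split_ifs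
  · exact exchange_plus_plus.symm
  · exact exchange_minus_plus.symm

theorem centralElement_mem_center (hq0 : q ≠ 0) (k : ℕ) :
    centralElement q n k ∈ Subalgebra.center ℂ (Uq q n) := by
  rw [Subalgebra.mem_center_iff]
  intro b
  obtain ⟨x, rfl⟩ := RingQuot.mkAlgHom_surjective ℂ (Rel q n) b
  change Commute _ _
  induction x using FreeAlgebra.induction with
  | grade0 r => rw [AlgHom.commutes]; exact Algebra.commute_algebraMap_left r _
  | grade1 x =>
    cases x with
    | plus i j => exact commute_LPlus hq0 k i j
    | minus i j => exact commute_LMinus hq0 k i j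
  | mul a b ha hb => rw [map_mul]; exact ha.mul_left hb
  | add a b ha hb => rw [map_add]; exact ha.add_left hb

end center

/-! ### Inversion generating function with marked positions. -/

section generating

/-- The permutation of `Fin (n + 1)` whose value at `p` is maximal and whose other values are
listed by `τ`. -/
def insertLast {n : ℕ} (p : Fin (n + 1)) (τ : Equiv.Perm (Fin n)) : Equiv.Perm (Fin (n + 1)) :=
  (finSuccEquiv' p).trans ((Equiv.optionCongr τ).trans (finSuccEquiv' (Fin.last n)).symm)

theorem insertLast_self {n : ℕ} (p : Fin (n + 1)) (τ : Equiv.Perm (Fin n)) :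
    insertLast p τ p = Fin.last n := by
  simp [insertLast]

theorem insertLast_succAbove {n : ℕ} (p : Fin (n + 1)) (τ : Equiv.Perm (Fin n)) (i : Fin n) :
    insertLast p τ (p.succAbove i) = (τ i).castSucc := by
  simp [insertLast]

theorem insertLast_bijective (n : ℕ) : Function.Bijective
    fun x : Fin (n + 1) × Equiv.Perm (Fin n) => insertLast x.1 x.2 := by
  rw [Fintype.bijective_iff_injective_and_card]
  refine ⟨?_, by simp [Fintype.card_perm, Nat.factorial_succ]⟩
  rintro ⟨p, τ⟩ ⟨p', τ'⟩ h
  simp only at h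
  have hp : p = p' := (insertLast p τ).injective (by
    rw [insertLast_self, h, insertLast_self])
  subst hp
  refine Prod.ext rfl (Equiv.ext fun i => Fin.castSucc_injective n ?_)
  rw [← insertLast_succAbove p, h, insertLast_succAbove]

theorem inversions_eq_sum {n : ℕ} (σ : Equiv.Perm (Fin n)) :
    inversions σ = ∑ i, ∑ j, if i < j ∧ σ j < σ i then 1 else 0 := by
  rw [inversions, Finset.card_filter, Fintype.sum_prod_type]

/-- The maximal value at `p` forms an inversion with each of the `n - p` later positions and with no
earlier one. -/
theorem inversions_insertLast {n : ℕ} (p : Fin (n + 1)) (τ : Equiv.Perm (Fin n)) :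
    inversions (insertLast p τ) = inversions τ + (n - p) := by
  rw [inversions_eq_sum, inversions_eq_sum, Fin.sum_univ_succAbove _ p, add_comm]
  congr 1
  · refine Finset.sum_congr rfl fun i _ => ?_
    rw [Fin.sum_univ_succAbove _ p]
    simp only [insertLast_self, insertLast_succAbove, Fin.succAbove_lt_succAbove_iff,
      Fin.castSucc_lt_castSucc_iff]
    simp [(Fin.le_last _).not_gt]
  · rw [Fin.sum_univ_succAbove _ p]
    simp only [insertLast_self, insertLast_succAbove, Fin.castSucc_lt_last, and_true,
      lt_self_iff_false, Fin.lt_succAbove_iff_le_castSucc, Fin.le_def, Fin.val_castSucc]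
    rw [Fin.sum_univ_eq_sum_range (fun i => if (p : ℕ) ≤ i then 1 else 0) n,
      ← Finset.sum_filter, Finset.sum_const, smul_eq_mul, mul_one, if_neg (by simp), zero_add,
      ← Nat.card_Ico]
    congr 1
    ext i
    simp [and_comm]

/-- `1 + t + ⋯ + t^{m-1}`. -/
def geom (t : ℂ) (m : ℕ) : ℂ := ∑ i ∈ Finset.range m, t ^ i

/-- The generating function of inversions, with the first `k` values marked by `x`. -/
def invGen (t : ℂ) (n k : ℕ) (x : ℕ → ℂ) : ℂ :=
  ∑ σ : Equiv.Perm (Fin n), t ^ inversions σ * ∏ i : Fin n, if (i : ℕ) < k then x (σ i) else 1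

/-- The elementary symmetric function of degree `k` in `y 0, …, y (n - 1)`. -/
def elemSymm (n k : ℕ) (y : ℕ → ℂ) : ℂ :=
  ∑ I ∈ (Finset.range n).powersetCard k, ∏ i ∈ I, y i

theorem elemSymm_succ (n k : ℕ) (y : ℕ → ℂ) :
    elemSymm (n + 1) (k + 1) y = elemSymm n (k + 1) y + y n * elemSymm n k y := by
  unfold elemSymm
  rw [Finset.range_add_one, Finset.powersetCard_succ_insert Finset.notMem_range_self,
    Finset.sum_union, Finset.sum_image, Finset.mul_sum]
  · congr 1
    refine Finset.sum_congr rfl fun I hI => ?_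
    rw [Finset.prod_insert]
    intro h
    exact Finset.notMem_range_self ((Finset.mem_powersetCard.1 hI).1 h)
  · intro I hI J hJ h
    have hI' : n ∉ I := fun h => Finset.notMem_range_self ((Finset.mem_powersetCard.1 hI).1 h)
    have hJ' : n ∉ J := fun h => Finset.notMem_range_self ((Finset.mem_powersetCard.1 hJ).1 h)
    rw [← Finset.erase_insert hI', ← Finset.erase_insert hJ']
    exact congrArg (Finset.erase · n) h
  · rw [Finset.disjoint_left]
    intro I hI hI'
    obtain ⟨J, -, rfl⟩ := Finset.mem_image.1 hI'
    exact Finset.notMem_range_self ((Finset.mem_powersetCard.1 hI).1 (Finset.mem_insert_self n J))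

theorem prod_insertLast {n : ℕ} (k : ℕ) (x : ℕ → ℂ) (p : Fin (n + 1)) (τ : Equiv.Perm (Fin n)) :
    (∏ i : Fin (n + 1), if (i : ℕ) < k then x (insertLast p τ i) else 1) =
      if (p : ℕ) < k then x n * ∏ i : Fin n, (if (i : ℕ) < k - 1 then x (τ i) else 1)
      else ∏ i : Fin n, (if (i : ℕ) < k then x (τ i) else 1) := by
  rw [Fin.prod_univ_succAbove _ p, insertLast_self, Fin.val_last]
  simp only [insertLast_succAbove, Fin.val_castSucc]
  have hval : ∀ i : Fin n, (p.succAbove i : ℕ) = if (i : ℕ) < p then (i : ℕ) else i + 1 :=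
    fun i => by
      simp only [Fin.succAbove, Fin.lt_def, Fin.val_castSucc]
      split_ifs <;> simp
  split_ifs with hp
  · congr 1
    refine Finset.prod_congr rfl fun i _ => if_congr ?_ rfl rfl
    rw [hval]
    split_ifs <;> omega
  · rw [one_mul]
    refine Finset.prod_congr rfl fun i _ => if_congr ?_ rfl rfl
    rw [hval]
    split_ifs <;> omega

/-- The sum is split by the position of the largest value: among the first `k` positions it
contributes `x n` and uses up a mark, otherwise all `k` marks remain. -/
theorem invGen_succ (t : ℂ) (n k : ℕ) (hk : k ≤ n + 1) (x : ℕ → ℂ) :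
    invGen t (n + 1) k x = geom t (n + 1 - k) * invGen t n k x +
      t ^ (n + 1 - k) * geom t k * x n * invGen t n (k - 1) x := by
  have h : invGen t (n + 1) k x = ∑ p ∈ Finset.range (n + 1), t ^ (n - p) *
      if p < k then x n * invGen t n (k - 1) x else invGen t n k x := by
    rw [← Fin.sum_univ_eq_sum_range (fun p => t ^ (n - p) *
      if p < k then x n * invGen t n (k - 1) x else invGen t n k x), invGen,
      ← (insertLast_bijective n).sum_comp, Fintype.sum_prod_type]
    refine Finset.sum_congr rfl fun p _ => ?_
    simp only [inversions_insertLast, prod_insertLast]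
    split_ifs
    · simp only [invGen, Finset.mul_sum]
      refine Finset.sum_congr rfl fun τ _ => ?_
      ring
    · simp only [invGen, Finset.mul_sum]
      refine Finset.sum_congr rfl fun τ _ => ?_
      ring
  obtain ⟨m, hm⟩ := Nat.exists_eq_add_of_le hk
  have hm' : n + 1 - k = m := by omega
  rw [h, hm', hm, Finset.sum_range_add, add_comm]
  congr 1
  · rw [geom, ← Finset.sum_range_reflect, Finset.sum_mul]
    refine Finset.sum_congr rfl fun p hp => ?_
    rw [Finset.mem_range] at hp
    rw [if_neg (by omega), show n - (k + (m - 1 - p)) = p by omega]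
  · rw [geom, ← Finset.sum_range_reflect, Finset.mul_sum, Finset.sum_mul, Finset.sum_mul]
    refine Finset.sum_congr rfl fun p hp => ?_
    rw [Finset.mem_range] at hp
    rw [if_pos (by omega), show n - (k - 1 - p) = m + p by omega, pow_add]
    ring

/-- `∏_{i=1}^{m} (1 + t + ⋯ + t^{i-1})`. -/
def geomFactorial (t : ℂ) (m : ℕ) : ℂ := ∏ i ∈ Finset.range m, geom t (i + 1)

theorem geomFactorial_succ (t : ℂ) (m : ℕ) :
    geomFactorial t (m + 1) = geomFactorial t m * geom t (m + 1) :=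
  Finset.prod_range_succ _ _

theorem elemSymm_zero (n : ℕ) (y : ℕ → ℂ) : elemSymm n 0 y = 1 := by
  simp [elemSymm]

theorem elemSymm_eq_zero {n k : ℕ} (h : n < k) (y : ℕ → ℂ) : elemSymm n k y = 0 := by
  rw [elemSymm, Finset.powersetCard_eq_empty.2 (by simpa using h), Finset.sum_empty]

theorem invGen_eq (t : ℂ) (n k : ℕ) (hk : k ≤ n) (x : ℕ → ℂ) :
    t ^ k.choose 2 * invGen t n k x =
      geomFactorial t k * geomFactorial t (n - k) * elemSymm n k fun i => t ^ i * x i := by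
  induction n generalizing k with
  | zero =>
    obtain rfl : k = 0 := by omega
    simp [invGen, elemSymm, geomFactorial, inversions]
  | succ n ih =>
    rw [invGen_succ t n k hk]
    cases k with
    | zero =>
      have := ih 0 (by omega)
      simp only [Nat.choose_zero_succ, pow_zero, one_mul, elemSymm_zero, mul_one, tsub_zero,
        geomFactorial_succ] at this ⊢
      rw [this]
      -- The second term carries the empty sum `geom t 0`, so the truncated index `k - 1` does no
      -- harm.
      simp [geom]
      ring
    | succ k =>
      obtain ⟨m, rfl⟩ := Nat.exists_eq_add_of_le (Nat.le_of_succ_le_succ hk)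
      have h1 := ih k (by omega)
      rw [elemSymm_succ, geomFactorial_succ, Nat.choose_succ_succ' k 1, Nat.choose_one_right,
        show k + m + 1 - (k + 1) = m by omega, Nat.add_sub_cancel]
      rw [show k + m - k = m by omega] at h1
      cases m with
      | zero =>
        -- All positions are marked: the induction hypothesis does not cover `k + 1` marks on `k`
        -- positions, but that term has the factor `geom t 0`.
        rw [elemSymm_eq_zero (by omega)]
        have h0 : geom t 0 = 0 := by simp [geom]
        rw [h0]
        simp only [add_zero] at h1 ⊢
        linear_combination (t ^ k * geom t (k + 1) * x k) * h1
      | succ m =>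
        have h2 := ih (k + 1) (by omega)
        rw [geomFactorial_succ, Nat.choose_succ_succ' k 1, Nat.choose_one_right,
          show k + (m + 1) - (k + 1) = m by omega] at h2
        rw [geomFactorial_succ] at h1 ⊢
        linear_combination geom t (m + 1) * h2 +
          (t ^ (k + (m + 1)) * geom t (k + 1) * x (k + (m + 1))) * h1

end generating

/-! ### Action on a lowest weight vector. -/

section lowestWeight

variable {q : ℂ} {n : ℕ} {μ : Fin n → ℤ} {V : Type*} [AddCommGroup V] [Module ℂ V]
  [Module (Uq q n) V] [IsScalarTower ℂ (Uq q n) V] {v : V}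

theorem LPlus_eq_zero {i j : Fin n} (h : j < i) : LPlus q n i j = 0 := by
  rw [LPlus, RingQuot.mkAlgHom_rel ℂ (Rel.plus_upper i j h), map_zero]

theorem LMinus_eq_zero {i j : Fin n} (h : i < j) : LMinus q n i j = 0 := by
  rw [LMinus, RingQuot.mkAlgHom_rel ℂ (Rel.minus_lower i j h), map_zero]

theorem LMinus_mul_LPlus (i : Fin n) : LMinus q n i i * LPlus q n i i = 1 := by
  rw [LMinus, LPlus, ← map_mul, RingQuot.mkAlgHom_rel ℂ (Rel.minus_mul_plus i), map_one]

theorem LMinus_smul (hq0 : q ≠ 0) (hv : IsLowestWeightVector q n μ v) (i j : Fin n) :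
    LMinus q n i j • v = (if i = j then q ^ (-μ i) else 0) • v := by
  rcases lt_trichotomy i j with h | rfl | h
  · rw [LMinus_eq_zero h, if_neg h.ne, zero_smul, zero_smul]
  · have h1 : LMinus q n i i • LPlus q n i i • v = v := by
      rw [← mul_smul, LMinus_mul_LPlus, one_smul]
    rw [hv.diag_smul, smul_comm] at h1
    rw [if_pos rfl, zpow_neg, eq_inv_smul_iff₀ (zpow_ne_zero _ hq0), h1]
  · rw [hv.lower_smul i j h, if_neg h.ne', zero_smul]

theorem prod_map_smul {A ι : Type*} [Ring A] [Algebra ℂ A] [Module A V] [IsScalarTower ℂ A V]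
    (g : ι → A) (s : ι → ℂ) (l : List ι) (h : ∀ i ∈ l, g i • v = s i • v) :
    (l.map g).prod • v = (l.map s).prod • v := by
  induction l with
  | nil => simp
  | cons i l ih =>
    rw [List.map_cons, List.prod_cons, mul_smul, ih fun j hj => h j (List.mem_cons_of_mem _ hj),
      smul_comm, h i List.mem_cons_self, List.map_cons, List.prod_cons, smul_smul, mul_comm]

theorem prod_entries_smul (hq0 : q ≠ 0) (hv : IsLowestWeightVector q n μ v) (k : ℕ)
    (σ σ' : Equiv.Perm (Fin n)) :
    (List.ofFn fun i : Fin n =>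
      if (i : ℕ) < k then LPlus q n (σ i) (σ' i) else LMinus q n (σ i) (σ' i)).prod • v =
    (if σ = σ' then ∏ i : Fin n, if (i : ℕ) < k then q ^ μ (σ i) else q ^ (-μ (σ i)) else 0) •
      v := by
  rw [List.ofFn_eq_map]
  split_ifs with h
  · subst h
    rw [prod_map_smul _ (fun i : Fin n => if (i : ℕ) < k then q ^ μ (σ i) else q ^ (-μ (σ i))),
      ← List.ofFn_eq_map, List.prod_ofFn]
    intro i _
    split_ifs
    · exact hv.diag_smul _
    · rw [LMinus_smul hq0 hv, if_pos rfl]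
  · rw [zero_smul]
    -- The L⁻ factors act first, and any off-diagonal one kills `v`.
    by_cases hm : ∃ i : Fin n, k ≤ i ∧ σ i ≠ σ' i
    · obtain ⟨i, hki, hi⟩ := hm
      have hmem : ∀ j : Fin n, j ∈ (List.finRange n).drop k → k ≤ j := by
        intro j hj
        obtain ⟨m, hm, rfl⟩ := List.mem_iff_getElem.1 hj
        simp
      have hi' : i ∈ (List.finRange n).drop k := by
        rw [List.mem_iff_getElem]
        exact ⟨i - k, by simp; omega, by simp [hki]⟩
      have hdrop := prod_map_smul (v := v)
        (fun i : Fin n => if (i : ℕ) < k then LPlus q n (σ i) (σ' i) else LMinus q n (σ i) (σ' i))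
        (fun i : Fin n => if σ i = σ' i then q ^ (-μ (σ i)) else 0) ((List.finRange n).drop k)
        fun j hj => by
          rw [if_neg (not_lt.2 (hmem j hj)), LMinus_smul hq0 hv]
      rw [← List.take_append_drop k (List.finRange n), List.map_append, List.prod_append,
        mul_smul, hdrop, List.prod_eq_zero (List.mem_map.2 ⟨i, hi', if_neg hi⟩), zero_smul,
        smul_zero]
    · push Not at hm
      -- Two distinct permutations have equal sums of values, so one cannot dominate the other; the
      -- resulting factor lies below the diagonal of L⁺ and is zero.
      have : ∃ i, σ' i < σ i := by
        by_contra! hle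
        apply h
        have hsum : ∑ i, (σ i : ℕ) = ∑ i, (σ' i : ℕ) := by
          rw [Equiv.sum_comp σ fun i => (i : ℕ), Equiv.sum_comp σ' fun i => (i : ℕ)]
        have := (Finset.sum_eq_sum_iff_of_le fun i _ => Fin.le_def.1 (hle i)).1 hsum
        exact Equiv.ext fun i => Fin.ext (this i (Finset.mem_univ i))
      obtain ⟨i, hi⟩ := this
      have hik : (i : ℕ) < k := by
        by_contra! hk
        rw [hm i hk] at hi
        exact lt_irrefl _ hi
      rw [List.prod_eq_zero, zero_smul]
      refine List.mem_map.2 ⟨i, List.mem_finRange i, ?_⟩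
      rw [if_pos hik, LPlus_eq_zero hi]

theorem centralElement_smul (hq0 : q ≠ 0) (hv : IsLowestWeightVector q n μ v) (k : ℕ) :
    centralElement q n k • v = (∑ σ : Equiv.Perm (Fin n), (q ^ 2) ^ inversions σ *
      ∏ i : Fin n, if (i : ℕ) < k then q ^ μ (σ i) else q ^ (-μ (σ i))) • v := by
  simp only [centralElement, Finset.sum_smul, smul_assoc, prod_entries_smul hq0 hv, ite_smul,
    zero_smul, smul_ite, smul_zero]
  refine Finset.sum_congr rfl fun σ _ => ?_
  rw [Finset.sum_ite_eq Finset.univ σ, if_pos (Finset.mem_univ _), smul_smul, ← two_mul, pow_mul,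
    neg_sq]

end lowestWeight

/-! ### The eigenvalue in terms of q-factorials. -/

section eigenvalue

theorem geom_sq {q : ℂ} (hq0 : q ≠ 0) (hq2 : q ^ 2 ≠ 1) (m : ℕ) :
    geom (q ^ 2) (m + 1) = q ^ m * qInt q (m + 1) := by
  have h1 : q ^ 2 - 1 ≠ 0 := sub_ne_zero.2 hq2
  have h2 : q - q⁻¹ ≠ 0 := by
    intro h
    apply h1
    field_simp at h
    linear_combination h
  rw [geom, geom_sum_eq hq2, qInt, div_eq_iff h1, ← mul_div_assoc, div_mul_eq_mul_div,
    eq_div_iff h2, inv_pow]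
  field_simp
  ring

theorem qFactorial_succ (q : ℂ) (m : ℕ) :
    qFactorial q (m + 1) = qFactorial q m * qInt q (m + 1) :=
  Finset.prod_range_succ _ _

theorem geomFactorial_sq {q : ℂ} (hq0 : q ≠ 0) (hq2 : q ^ 2 ≠ 1) (m : ℕ) :
    geomFactorial (q ^ 2) m = q ^ m.choose 2 * qFactorial q m := by
  induction m with
  | zero => simp [geomFactorial, qFactorial]
  | succ m ih =>
    rw [geomFactorial_succ, ih, geom_sq hq0 hq2, qFactorial_succ, Nat.choose_succ_succ' m 1,
      Nat.choose_one_right, pow_add]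
    ring

theorem elemSymm_eq_sum_fin (n k : ℕ) (y : ℕ → ℂ) : elemSymm n k y =
    ∑ I ∈ (Finset.univ : Finset (Fin n)).powersetCard k, ∏ i ∈ I, y i := by
  have : (Finset.univ : Finset (Fin n)).map Fin.valEmbedding = Finset.range n := by
    ext i
    simp only [Finset.mem_map, Finset.mem_univ, true_and, Fin.valEmbedding_apply,
      Finset.mem_range]
    exact ⟨by rintro ⟨j, rfl⟩; exact j.2, fun h => ⟨⟨i, h⟩, rfl⟩⟩
  rw [elemSymm, ← this, Finset.powersetCard_map, Finset.sum_map]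
  simp [Finset.mapEmbedding_apply]

theorem choose_two_add (k m : ℕ) :
    (k + m).choose 2 = k.choose 2 + m.choose 2 + k * m := by
  induction m with
  | zero => simp
  | succ m ih =>
    rw [← add_assoc, Nat.choose_succ_succ' (k + m) 1, Nat.choose_succ_succ' m 1, ih,
      Nat.choose_one_right, Nat.choose_one_right]
    ring

theorem two_mul_choose_two (k : ℕ) : (2 : ℤ) * (k.choose 2 : ℤ) = k * (k - 1) := by
  induction k with
  | zero => simp
  | succ k ih =>
    rw [Nat.choose_succ_succ' k 1, Nat.choose_one_right]
    push_cast
    linear_combination ih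

theorem sum_perm_eq {q : ℂ} (hq0 : q ≠ 0) (hq2 : q ^ 2 ≠ 1) {n k : ℕ} (hk : k ≤ n)
    (lam : Fin n → ℕ) :
    (∑ σ : Equiv.Perm (Fin n), (q ^ 2) ^ inversions σ * ∏ i : Fin n,
      if (i : ℕ) < k then q ^ (-(lam (σ i) : ℤ)) else q ^ (-(-(lam (σ i) : ℤ)))) =
    q ^ ((∑ i, (lam i : ℤ)) + (n.choose 2 : ℤ) + (k : ℤ) * ((n : ℤ) - 1)) *
      qFactorial q k * qFactorial q (n - k) *
      ∑ I ∈ (Finset.univ : Finset (Fin n)).powersetCard k,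
        q ^ (∑ i ∈ I, (-2 * (lam i : ℤ) + 2 * (((i : ℕ) : ℤ) + 1 - (n : ℤ)))) := by
  -- A marked position has weight q^{-λ} = q^{λ} q^{-2λ}, so q^{|λ|} factors out and `x` records the
  -- remaining q^{-2λ}; its value beyond `n` plays no role.
  set x : ℕ → ℂ := fun i => if h : i < n then q ^ (-2 * (lam ⟨i, h⟩ : ℤ)) else 0 with hx
  have hxv : ∀ i : Fin n, x i = q ^ (-2 * (lam i : ℤ)) := fun i => by simp [hx]
  have hprod : ∀ (s : Finset (Fin n)) (w : Fin n → ℤ), ∏ i ∈ s, q ^ w i = q ^ ∑ i ∈ s, w i := by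
    intro s w
    induction s using Finset.cons_induction with
    | empty => simp
    | cons a s ha ih => rw [Finset.prod_cons, Finset.sum_cons, zpow_add₀ hq0, ih]
  have h1 : (∑ σ : Equiv.Perm (Fin n), (q ^ 2) ^ inversions σ * ∏ i : Fin n,
      if (i : ℕ) < k then q ^ (-(lam (σ i) : ℤ)) else q ^ (-(-(lam (σ i) : ℤ)))) =
      q ^ (∑ i, (lam i : ℤ)) * invGen (q ^ 2) n k x := by
    rw [invGen, Finset.mul_sum]
    refine Finset.sum_congr rfl fun σ _ => ?_
    rw [← hprod, ← Equiv.prod_comp σ fun i => q ^ (lam i : ℤ), mul_left_comm,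
      ← Finset.prod_mul_distrib]
    congr 1
    refine Finset.prod_congr rfl fun i _ => ?_
    split_ifs
    · rw [hxv, ← zpow_add₀ hq0]
      congr 1
      ring
    · rw [neg_neg, mul_one]
  -- With indices from zero, 2i = 2(n - 1) + 2(i + 1 - n), and each of the `k` chosen indices
  -- contributes the shift 2(n - 1).
  have h2 : elemSymm n k (fun i => (q ^ 2) ^ i * x i) = q ^ (2 * (k : ℤ) * ((n : ℤ) - 1)) *
      ∑ I ∈ (Finset.univ : Finset (Fin n)).powersetCard k,
        q ^ (∑ i ∈ I, (-2 * (lam i : ℤ) + 2 * (((i : ℕ) : ℤ) + 1 - (n : ℤ)))) := by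
    rw [elemSymm_eq_sum_fin, Finset.mul_sum]
    refine Finset.sum_congr rfl fun I hI => ?_
    have hc := (Finset.mem_powersetCard.1 hI).2
    have : q ^ (2 * (k : ℤ) * ((n : ℤ) - 1)) = ∏ i ∈ I, q ^ (2 * ((n : ℤ) - 1)) := by
      rw [hprod, Finset.sum_const, hc, nsmul_eq_mul]
      congr 1
      ring
    rw [this, ← hprod, ← Finset.prod_mul_distrib]
    refine Finset.prod_congr rfl fun i _ => ?_
    rw [hxv, ← pow_mul, ← zpow_natCast, ← zpow_add₀ hq0, ← zpow_add₀ hq0]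
    congr 1
    push_cast
    ring
  have h3 := invGen_eq (q ^ 2) n k hk x
  rw [h2, geomFactorial_sq hq0 hq2, geomFactorial_sq hq0 hq2] at h3
  rw [h1]
  have h4 : invGen (q ^ 2) n k x = q ^ (-(2 * (k.choose 2 : ℤ))) *
      ((q ^ 2) ^ k.choose 2 * invGen (q ^ 2) n k x) := by
    rw [← mul_assoc, ← pow_mul, ← zpow_natCast q (2 * k.choose 2), ← zpow_add₀ hq0]
    simp
  obtain ⟨m, rfl⟩ := Nat.exists_eq_add_of_le hk
  have hexp : (∑ i, (lam i : ℤ)) + ((k + m).choose 2 : ℤ) + (k : ℤ) * (((k + m : ℕ) : ℤ) - 1) =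
      (∑ i, (lam i : ℤ)) + -(2 * (k.choose 2 : ℤ)) + (k.choose 2 : ℕ) +
        ((k + m - k).choose 2 : ℕ) + 2 * (k : ℤ) * (((k + m : ℕ) : ℤ) - 1) := by
    rw [choose_two_add, Nat.add_sub_cancel_left]
    have := two_mul_choose_two k
    push_cast
    linear_combination this
  rw [h4, h3, hexp, zpow_add₀ hq0, zpow_add₀ hq0, zpow_add₀ hq0, zpow_add₀ hq0, zpow_natCast,
    zpow_natCast]
  ring

end eigenvalue

end QuantumFRT

end

theorem mainTheorem8 (q : ℂ) (hq0 : q ≠ 0) (hq : ∀ m : ℕ, 0 < m → q ^ m ≠ 1)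
    (n k : ℕ) (hk1 : 1 ≤ k) (hkn : k ≤ n - 1) :
    QuantumFRT.centralElement q n k ∈ Subalgebra.center ℂ (QuantumFRT.Uq q n) ∧
    ∀ (lam : Fin n → ℕ), Antitone lam →
    ∀ (V : Type u) [AddCommGroup V] [Module ℂ V] [Module (QuantumFRT.Uq q n) V]
      [IsScalarTower ℂ (QuantumFRT.Uq q n) V] [IsSimpleModule (QuantumFRT.Uq q n) V],
      (∃ v₀ : V, QuantumFRT.IsLowestWeightVector q n (fun i => -(lam i : ℤ)) v₀) →
      ∀ v : V, QuantumFRT.centralElement q n k • v =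
        (q ^ ((∑ i, (lam i : ℤ)) + (n.choose 2 : ℤ) + (k : ℤ) * ((n : ℤ) - 1)) *
          QuantumFRT.qFactorial q k * QuantumFRT.qFactorial q (n - k) *
          ∑ I ∈ (Finset.univ : Finset (Fin n)).powersetCard k,
            q ^ (∑ i ∈ I, (-2 * (lam i : ℤ) + 2 * (((i : ℕ) : ℤ) + 1 - (n : ℤ))))) • v := by
  refine ⟨QuantumFRT.centralElement_mem_center hq0 k, ?_⟩
  rintro lam - V _ _ _ _ _ ⟨v₀, hv₀⟩ v
  -- By simplicity every vector is `u • v₀`, and the central element passes `u` to act on `v₀`.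
  obtain ⟨u, rfl⟩ := IsSimpleModule.toSpanSingleton_surjective (QuantumFRT.Uq q n) hv₀.ne_zero v
  have hc := Subalgebra.mem_center_iff.1 (QuantumFRT.centralElement_mem_center (n := n) hq0 k) u
  rw [LinearMap.toSpanSingleton_apply, smul_smul, ← hc, mul_smul,
    QuantumFRT.centralElement_smul hq0 hv₀, smul_comm,
    QuantumFRT.sum_perm_eq hq0 (hq 2 two_pos) (by omega)]
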